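/- Let $X$ be an irreducible complex affine variety with coordinate ring $\mathbb{C}[X]$ (a finitely generated $\mathbb{C}$-algebra that is an integral domain) and function field $\mathbb{C}(X)$. A derivation $\delta$ of the $\mathbb{C}$-algebra $\mathbb{C}[X]$ is *locally nilpotent* if for every $f\in\mathbb{C}[X]$ there is $k\ge 0$ with $\delta^k(f)=0$; it extends uniquely to a derivation of $\mathbb{C}(X)$. Let $\mathrm{D}(X)\subseteq\mathbb{C}[X]$ be the $\mathbb{C}$-subalgebra generated by the kernels $\ker\delta\subseteq\mathbb{C}[X]$ of all nonzero locally nilpotent derivations $\delta$ of $\mathbb{C}[X]$, and let $\mathrm{FD}(X)\subseteq\mathbb{C}(X)$ be the subfield generated over $\mathbb{C}$ by the kernels in $\mathbb{C}(X)$ of the extensions of all these $\delta$. Suppose that there is a finite collection $f_1,\dots,f_N\in\mathbb{C}[X]$ such that: 1. for each $k$ there is a nonzero locally nilpotent derivation $\delta_k$ of $\mathbb{C}[X]$ with $f_k\in\ker\delta_k$; 2. $f_1,\dots,f_N$ separate the points of a nonempty Zariski open subset $U$ of $X$: for distinct points $x,y\in U$ there is $k$ with $f_k(x)\ne f_k(y)$;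 3. for general $x\in X$ (that is, for all points $x$ of some nonempty Zariski open subset of $X$) the differentials $df_1(x),\dots,df_N(x)$ separate the tangent vectors: for distinct $v,w$ in the Zariski tangent space $T_xX$ there is $k$ with $df_k(x)(v)\neq df_k(x)(w)$. Let $F:X\to\mathbb{C}^N$, $F(x)=(f_1(x),\dots,f_N(x))$. Then there is a nonempty Zariski open subset $U'\subseteq U$ such that $F|_{U'}$ is an open immersion of $U'$ into the Zariski closure of $F(X)$ in $\mathbb{C}^N$ (that is, an isomorphism of $U'$ onto a Zariski open subset of that closure), and $\mathrm{FD}(X)=\mathbb{C}(X)$. If moreover $f_1,\dots,f_N$ separate all points of $X$, their differentials separate the tangent vectors at every point of $X$, and $F$ is a closed embedding of $X$ into $\mathbb{C}^N$, then $\mathrm{D}(X)=\mathbb{C}[X]$. -/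

import Mathlib

open AlgebraicGeometry CategoryTheory

/-!
Throughout, an (irreducible) complex affine variety `X` is given by its coordinate ring
`A = ℂ[X]`, a finitely generated `ℂ`-algebra that is an integral domain.
As a scheme it is `Spec A`; its (closed) points are the `ℂ`-algebra maps `A → ℂ`
(evaluation at the point), and its function field `ℂ(X)` is `FractionRing A`.
-/

namespace AffineVar

/-! ### Locally nilpotent derivations and the Derksen invariants -/

/-- A derivation `δ` of `ℂ[X]` is locally nilpotent if each `f` is killed by some power of `δ`. -/
def IsLND {A : Type} [CommRing A] [Algebra ℂ A] (δ : Derivation ℂ A A) : Prop :=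
  ∀ f : A, ∃ k : ℕ, (δ : A → A)^[k] f = 0

/-- Every element of the field of fractions is a quotient. -/
theorem exists_frac {A : Type} [CommRing A] [IsDomain A] (g : FractionRing A) : ∃ a b : A, b ≠ 0 ∧
    g * algebraMap A (FractionRing A) b = algebraMap A (FractionRing A) a :=
  ⟨_, _, nonZeroDivisors.ne_zero (IsLocalization.sec (nonZeroDivisors A) g).2.2,
    IsLocalization.sec_spec (nonZeroDivisors A) g⟩

section Extension

variable {A : Type} [CommRing A] [IsDomain A] [Algebra ℂ A]

/-- The value at `g = n / d` of the extension of `δ` to the field of fractions,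
`δ g = (δ n - g * δ d) / d`, which is the quotient rule. -/
noncomputable def extendFun (δ : Derivation ℂ A A) (g : FractionRing A) : FractionRing A :=
  let s := IsLocalization.sec (nonZeroDivisors A) g
  (algebraMap A (FractionRing A) (δ s.1) - g * algebraMap A (FractionRing A) (δ s.2)) /
    algebraMap A (FractionRing A) s.2

/-- The quotient rule holds for every way of writing `g = a / b`. -/
theorem extendFun_eq (δ : Derivation ℂ A A) {g : FractionRing A} {a b : A} (hb : b ≠ 0)
    (h : g * algebraMap A (FractionRing A) b = algebraMap A (FractionRing A) a) :
    extendFun δ g = (algebraMap A (FractionRing A) (δ a) - g * algebraMap A (FractionRing A) (δ b)) /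
      algebraMap A (FractionRing A) b := by
  have hs := IsLocalization.sec_spec (nonZeroDivisors A) g
  have hd : ((IsLocalization.sec (nonZeroDivisors A) g).2 : A) ≠ 0 :=
    nonZeroDivisors.ne_zero (IsLocalization.sec (nonZeroDivisors A) g).2.2
  simp only [extendFun]
  generalize (IsLocalization.sec (nonZeroDivisors A) g).1 = n at *
  generalize ((IsLocalization.sec (nonZeroDivisors A) g).2 : A) = d at *
  have inj := IsFractionRing.injective A (FractionRing A)
  have hb' : algebraMap A (FractionRing A) b ≠ 0 := fun h0 => hb (inj (by rw [h0, map_zero]))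
  have hd' : algebraMap A (FractionRing A) d ≠ 0 := fun h0 => hd (inj (by rw [h0, map_zero]))
  have e : a * d = n * b := by
    apply inj
    rw [map_mul, map_mul, ← h, ← hs]
    ring
  have e2 := congrArg (fun t => algebraMap A (FractionRing A) (δ t)) e
  simp only [Derivation.leibniz, smul_eq_mul, map_add, map_mul] at e2
  rw [← h, ← hs] at e2
  rw [div_eq_div_iff hd' hb']
  linear_combination -e2

/-- The (unique) extension of a derivation of `ℂ[X]` to a derivation of the field `ℂ(X)`. -/
noncomputable def extend (δ : Derivation ℂ A A) :
    Derivation ℂ (FractionRing A) (FractionRing A) :=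
  have inj := IsFractionRing.injective A (FractionRing A)
  have ne : ∀ {b : A}, b ≠ 0 → algebraMap A (FractionRing A) b ≠ 0 :=
    fun hb h0 => hb (inj (by rw [h0, map_zero]))
  Derivation.mk'
    { toFun := extendFun δ
      map_add' := by
        intro x y
        obtain ⟨a, b, hb, h⟩ := exists_frac x
        obtain ⟨c, d, hd, h'⟩ := exists_frac y
        have hb' := ne hb
        have hd' := ne hd
        have e : (x + y) * algebraMap A (FractionRing A) (b * d) =
            algebraMap A (FractionRing A) (a * d + c * b) := by
          simp only [map_add, map_mul, ← h, ← h']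
          ring
        rw [extendFun_eq δ hb h, extendFun_eq δ hd h', extendFun_eq δ (mul_ne_zero hb hd) e]
        simp only [map_add, map_mul, Derivation.leibniz, smul_eq_mul, ← h, ← h']
        field_simp
        ring
      map_smul' := by
        intro r x
        have key : ∀ c : A, algebraMap A (FractionRing A) (r • c) =
            r • algebraMap A (FractionRing A) c :=
          fun c => (IsScalarTower.toAlgHom ℂ A (FractionRing A)).toLinearMap.map_smul r c
        obtain ⟨a, b, hb, h⟩ := exists_frac x
        have hb' := ne hb
        have e : (r • x) * algebraMap A (FractionRing A) b =
            algebraMap A (FractionRing A) (r • a) := by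
          rw [key, ← h, smul_mul_assoc]
        rw [extendFun_eq δ hb h, extendFun_eq δ hb e]
        rw [Derivation.map_smul, key, smul_mul_assoc, ← smul_sub, RingHom.id_apply, smul_div_assoc] }
    (by
      intro x y
      obtain ⟨a, b, hb, h⟩ := exists_frac x
      obtain ⟨c, d, hd, h'⟩ := exists_frac y
      have hb' := ne hb
      have hd' := ne hd
      have e : (x * y) * algebraMap A (FractionRing A) (b * d) =
          algebraMap A (FractionRing A) (a * c) := by
        simp only [map_mul, ← h, ← h']
        ring
      change extendFun δ (x * y) = x • extendFun δ y + y • extendFun δ x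
      rw [extendFun_eq δ hb h, extendFun_eq δ hd h', extendFun_eq δ (mul_ne_zero hb hd) e]
      simp only [map_add, map_mul, Derivation.leibniz, smul_eq_mul, ← h, ← h']
      field_simp
      ring)

/-- `extend δ` does extend `δ`. -/
theorem extend_algebraMap (δ : Derivation ℂ A A) (a : A) :
    extend δ (algebraMap A (FractionRing A) a) = algebraMap A (FractionRing A) (δ a) := by
  change extendFun δ _ = _
  rw [extendFun_eq δ one_ne_zero (a := a) (by simp)]
  simp

end Extension

/-- The Derksen invariant `D(X)`: the subalgebra of `ℂ[X]` generated by the kernels of all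
non-trivial locally nilpotent derivations. -/
def derksen (A : Type) [CommRing A] [Algebra ℂ A] : Subalgebra ℂ A :=
  Algebra.adjoin ℂ {f | ∃ δ : Derivation ℂ A A, IsLND δ ∧ δ ≠ 0 ∧ δ f = 0}

/-- The field Derksen invariant `FD(X)`: the subfield of `ℂ(X)` generated (over `ℂ`) by the kernels
in `ℂ(X)` of all non-trivial locally nilpotent derivations of `ℂ[X]`. -/
noncomputable def fieldDerksen (A : Type) [CommRing A] [IsDomain A] [Algebra ℂ A] :
    IntermediateField ℂ (FractionRing A) :=
  IntermediateField.adjoin ℂ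
    {g | ∃ δ : Derivation ℂ A A, IsLND δ ∧ δ ≠ 0 ∧ extend δ g = 0}

/-! ### Points and tangent vectors -/

/-- The closed point of `Spec A` at which the functions `f : A` have the values `x f`. -/
def pt {A : Type} [CommRing A] [Algebra ℂ A] (x : A →ₐ[ℂ] ℂ) : Spec (.of A) :=
  (⟨RingHom.ker x, RingHom.ker_isPrime x⟩ : PrimeSpectrum A)

/-- The Zariski tangent space `T_x X`, as the space of point derivations of `ℂ[X]` at `x`. -/
def tangentSpace {A : Type} [CommRing A] [Algebra ℂ A] (x : A →ₐ[ℂ] ℂ) :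
    Submodule ℂ (A →ₗ[ℂ] ℂ) where
  carrier := {v | ∀ f g : A, v (f * g) = x f * v g + x g * v f}
  add_mem' := by
    intro v w hv hw f g
    simp only [LinearMap.add_apply, hv f g, hw f g]
    ring
  zero_mem' := by simp
  smul_mem' := by
    intro c v hv f g
    simp only [LinearMap.smul_apply, hv f g, smul_eq_mul]
    ring

/-- The differential `df(x) : T_x X → ℂ`, `v ↦ v(f)`. -/
def differential {A : Type} [CommRing A] [Algebra ℂ A] (f : A) (x : A →ₐ[ℂ] ℂ) :
    tangentSpace x →ₗ[ℂ] ℂ where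
  toFun v := v.1 f
  map_add' _ _ := rfl
  map_smul' _ _ := rfl

/-- The functions `f₁, …, f_N` separate the points of the open set `U`. -/
def SeparatesPoints {A : Type} [CommRing A] [Algebra ℂ A] {N : ℕ} (f : Fin N → A)
    (U : (Spec (.of A)).Opens) : Prop :=
  ∀ x y : A →ₐ[ℂ] ℂ, pt x ∈ U → pt y ∈ U → x ≠ y → ∃ k, x (f k) ≠ y (f k)

/-- The differentials `df₁(x), …, df_N(x)` separate tangent vectors at `x`. -/
def SeparatesTangentVectors {A : Type} [CommRing A] [Algebra ℂ A] {N : ℕ} (f : Fin N → A)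
    (x : A →ₐ[ℂ] ℂ) : Prop :=
  ∀ v w : tangentSpace x, v ≠ w → ∃ k, differential (f k) x v ≠ differential (f k) x w

/-! ### The map to affine space -/

/-- The morphism `F = (f₁, …, f_N) : X → ℂ^N = Spec ℂ[t₁, …, t_N]`. -/
noncomputable def mapToAffineSpace {A : Type} [CommRing A] [Algebra ℂ A] {N : ℕ} (f : Fin N → A) :
    Spec (.of A) ⟶ Spec (.of (MvPolynomial (Fin N) ℂ)) :=
  Spec.map (CommRingCat.ofHom (MvPolynomial.aeval f).toRingHom)

end AffineVar

/-! Let B ⊆ A = ℂ[X] be a subalgebra containing the f_k. A closed point of Spec(A ⊗_B A) is a pair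
of points of X agreeing on B; over U such a pair is diagonal. By the Nullstellensatz, a ⊗ 1 - 1 ⊗ a
is nilpotent up to a factor u ⊗ u with D(u) ⊆ U. For fields K ⊆ L of characteristic 0, nilpotence of
a ⊗ 1 - 1 ⊗ a in L ⊗_K L forces a ∈ K (`mem_range_of_isNilpotent_tmul_sub`). So each a is a quotient
of elements of B (`exists_mul_mem_of_separatesPoints`). With B = ℂ[f_1, …, f_N], one common
denominator b gives B_b = A_b, hence the open immersion. With B = D(X), it gives FD(X) = ℂ(X). A
closed embedding makes the f_k generate A, so D(X) = A. -/

open TensorProduct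

/-! ### Nilpotents in L ⊗_K L and descent to K -/

section FieldExtension

variable {K L : Type*} [Field K] [Field L] [Algebra K L]

/-- If a ∉ K, some K-linear form kills 1 but not a; applying it to the left factor gives a
contradiction. -/
theorem mem_range_of_tmul_one_eq {a : L} (h : a ⊗ₜ[K] (1 : L) = 1 ⊗ₜ a) :
    a ∈ Set.range (algebraMap K L) := by
  by_contra ha
  have hn : a ∉ Submodule.span K {(1 : L)} := by
    rintro hm
    obtain ⟨c, rfl⟩ := Submodule.mem_span_singleton.1 hm
    exact ha ⟨c, by rw [Algebra.smul_def, mul_one]⟩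
  obtain ⟨φ, hφ, hle⟩ := Submodule.exists_le_ker_of_notMem hn
  have h1 : φ 1 = 0 := hle (Submodule.mem_span_singleton_self 1)
  have := congrArg (fun t => TensorProduct.lid K L (LinearMap.rTensor L φ t)) h
  simp only [LinearMap.rTensor_tmul, TensorProduct.lid_tmul, h1, zero_smul] at this
  exact hφ ((smul_eq_zero.1 this).resolve_right one_ne_zero)

/-- For transcendental a, flatness embeds K[X] ⊗ K[X] in L ⊗ L. That ring is reduced, being
polynomial over K[X], so a ⊗ 1 = 1 ⊗ a and a ∈ K, which is absurd. -/
theorem isAlgebraic_of_isNilpotent_tmul_sub {a : L}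
    (h : IsNilpotent (a ⊗ₜ[K] (1 : L) - 1 ⊗ₜ a)) : IsAlgebraic K a := by
  by_contra ht
  have hinj : Function.Injective (Polynomial.aeval (R := K) a) :=
    transcendental_iff_injective.1 ht
  have hmap : Function.Injective
      (Algebra.TensorProduct.map (Polynomial.aeval (R := K) a) (Polynomial.aeval (R := K) a)) :=
    TensorProduct.map_injective_of_flat_flat (Polynomial.aeval (R := K) a).toLinearMap
      (Polynomial.aeval (R := K) a).toLinearMap hinj hinj
  have hred : _root_.IsReduced (Polynomial K ⊗[K] Polynomial K) :=
    isReduced_of_injective (polyEquivTensor K (Polynomial K)).symm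
      (polyEquivTensor K (Polynomial K)).symm.injective
  have hn : IsNilpotent ((Polynomial.X ⊗ₜ 1 - 1 ⊗ₜ Polynomial.X :
      Polynomial K ⊗[K] Polynomial K)) := by
    rw [← IsNilpotent.map_iff hmap]
    simpa using h
  have h0 := congrArg (Algebra.TensorProduct.map (Polynomial.aeval (R := K) a)
    (Polynomial.aeval (R := K) a)) hn.eq_zero
  rw [map_sub, map_zero, sub_eq_zero] at h0
  simp only [Algebra.TensorProduct.map_tmul, Polynomial.aeval_X, map_one] at h0
  obtain ⟨c, hc⟩ := mem_range_of_tmul_one_eq h0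
  exact ht (hc ▸ isAlgebraic_algebraMap c)

theorem mem_range_of_isNilpotent_tmul_sub_of_isSeparable [Algebra.IsSeparable K L]
    [FiniteDimensional K L] {a : L} (h : IsNilpotent (a ⊗ₜ[K] (1 : L) - 1 ⊗ₜ a)) :
    a ∈ Set.range (algebraMap K L) := by
  have : Algebra.FormallyUnramified K L := Algebra.FormallyUnramified.of_isSeparable K L
  have hred : _root_.IsReduced (L ⊗[K] L) := Algebra.FormallyUnramified.isReduced_of_field L _
  exact mem_range_of_tmul_one_eq (sub_eq_zero.1 h.eq_zero)

/-- Flatness embeds K(a) ⊗ K(a) in L ⊗ L, which reduces to the finite extension K(a), separable in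
characteristic 0. -/
theorem mem_range_of_isNilpotent_tmul_sub [CharZero K] {a : L}
    (h : IsNilpotent (a ⊗ₜ[K] (1 : L) - 1 ⊗ₜ a)) : a ∈ Set.range (algebraMap K L) := by
  have ha := (isAlgebraic_of_isNilpotent_tmul_sub h).isIntegral
  have : FiniteDimensional K (IntermediateField.adjoin K {a}) :=
    IntermediateField.adjoin.finiteDimensional ha
  let E := IntermediateField.adjoin K {a}
  let x : E := ⟨a, IntermediateField.mem_adjoin_simple_self K a⟩
  have hmap : Function.Injective (Algebra.TensorProduct.map E.val E.val) :=
    TensorProduct.map_injective_of_flat_flat E.val.toLinearMap E.val.toLinearMap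
      E.val.injective E.val.injective
  have hn : IsNilpotent (x ⊗ₜ[K] (1 : E) - 1 ⊗ₜ x) := by
    rw [← IsNilpotent.map_iff hmap]
    simpa using h
  obtain ⟨c, hc⟩ := mem_range_of_isNilpotent_tmul_sub_of_isSeparable hn
  exact ⟨c, congrArg E.val hc⟩

end FieldExtension

/-- A weak form of the Nullstellensatz. -/
theorem isNilpotent_of_forall_algHom_eq_zero {k C : Type*} [Field k] [IsAlgClosed k] [CommRing C]
    [Algebra k C] [Algebra.FiniteType k C] {c : C} (h : ∀ χ : C →ₐ[k] k, χ c = 0) :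
    IsNilpotent c := by
  have : IsJacobsonRing C := isJacobsonRing_of_finiteType (A := k)
  rw [← mem_nilradical, nilradical, Ideal.radical_eq_jacobson, Ideal.jacobson, Ideal.mem_sInf]
  rintro m ⟨-, hm⟩
  let := Ideal.Quotient.field m
  have := finite_of_finite_type_of_isJacobsonRing k (C ⧸ m)
  let e : k ≃ₐ[k] C ⧸ m := AlgEquiv.ofBijective (Algebra.ofId k (C ⧸ m))
    IsAlgClosed.algebraMap_bijective_of_isIntegral
  have h0 := h (e.symm.toAlgHom.comp (Ideal.Quotient.mkₐ k m))
  exact Ideal.Quotient.eq_zero_iff_mem.1 ((map_eq_zero_iff _ e.symm.injective).1 h0)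

/-! ### From separated points to equal fraction fields -/

namespace AffineVar

/-- Over functions separating the points of a nonempty open subset, every regular function becomes
a scalar after passing to fields. -/
theorem algebraMap_mem_range_of_separatesPoints {A : Type} [CommRing A] [IsDomain A] [Algebra ℂ A]
    [Algebra.FiniteType ℂ A] {N : ℕ} (f : Fin N → A) {U : (Spec (.of A)).Opens}
    (hU : (U : Set (Spec (.of A))).Nonempty) (hpts : SeparatesPoints f U)
    (B : Subalgebra ℂ A) (hB : ∀ k, f k ∈ B) {K L : Type*} [Field K] [Field L] [Algebra B K]
    [Algebra A L] [FaithfulSMul A L]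
    [CharZero K] [Algebra K L] [IsScalarTower B K L] (a : A) :
    algebraMap A L a ∈ Set.range (algebraMap K L) := by
  obtain ⟨z, hz⟩ := hU
  obtain ⟨_, ⟨_, ⟨u, rfl⟩, rfl⟩, hzu, huU⟩ :=
    PrimeSpectrum.isBasis_basic_opens.exists_subset_of_mem_open hz U.isOpen
  have hu : u ≠ 0 := by
    rintro rfl
    rw [PrimeSpectrum.basicOpen_zero] at hzu
    exact hzu
  have : Algebra.FiniteType A (A ⊗[B] A) := by
    have : Algebra.FiniteType B A := .of_restrictScalars_finiteType ℂ B A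
    infer_instance
  have : Algebra.FiniteType ℂ (A ⊗[B] A) := .trans (S := A) inferInstance inferInstance
  -- If u vanishes at x or y, the second factor is 0; otherwise both points lie in U and agree on
  -- all f_k, so x = y and the first is 0.
  have hnil : IsNilpotent ((a ⊗ₜ[B] (1 : A) - 1 ⊗ₜ a) * (u ⊗ₜ[B] u)) := by
    refine isNilpotent_of_forall_algHom_eq_zero (k := ℂ) fun χ => ?_
    let x : A →ₐ[ℂ] ℂ := χ.comp Algebra.TensorProduct.includeLeft
    let y : A →ₐ[ℂ] ℂ := χ.comp (Algebra.TensorProduct.includeRight.restrictScalars ℂ)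
    have hxy : χ (u ⊗ₜ[B] u) = x u * y u := by
      simp [x, y, ← map_mul]
    rw [map_mul, map_sub, hxy]
    by_contra hne
    have hxu : x u ≠ 0 := fun h => hne (by rw [h]; ring)
    have hyu : y u ≠ 0 := fun h => hne (by rw [h]; ring)
    have hx : pt x ∈ U := huU (show u ∉ RingHom.ker x from hxu)
    have hy : pt y ∈ U := huU (show u ∉ RingHom.ker y from hyu)
    have heq : x = y := by
      by_contra hxy
      obtain ⟨k, hk⟩ := hpts x y hx hy hxy
      exact hk (congrArg χ (Algebra.TensorProduct.tmul_one_eq_one_tmul (⟨f k, hB k⟩ : B)))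
    have : χ (a ⊗ₜ[B] 1) = χ (1 ⊗ₜ a) := DFunLike.congr_fun heq a
    exact hne (by rw [this]; ring)
  let ψ : A →ₐ[B] L := IsScalarTower.toAlgHom B A L
  have : IsScalarTower B K (L ⊗[K] L) := .of_algebraMap_eq fun b => by
    rw [Algebra.TensorProduct.algebraMap_apply, ← IsScalarTower.algebraMap_apply B K L]
    rfl
  -- Transport to L ⊗_K L, where u ⊗ u becomes a unit and can be cancelled.
  let φ : A ⊗[B] A →ₐ[B] L ⊗[K] L := Algebra.TensorProduct.lift
    (((Algebra.TensorProduct.includeLeft : L →ₐ[K] L ⊗[K] L).restrictScalars B).comp ψ)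
    (((Algebra.TensorProduct.includeRight : L →ₐ[K] L ⊗[K] L).restrictScalars B).comp ψ)
    fun _ _ => Commute.all _ _
  have hφ (c d : A) : φ (c ⊗ₜ d) = algebraMap A L c ⊗ₜ algebraMap A L d := by
    refine (Algebra.TensorProduct.lift_tmul _ _ _ c d).trans ?_
    simp [ψ]
  have h := hnil.map φ
  rw [map_mul, map_sub, hφ, hφ, hφ, map_one] at h
  have hu' : algebraMap A L u ≠ 0 := by simpa using hu
  have hunit : IsUnit (algebraMap A L u ⊗ₜ[K] algebraMap A L u) := by
    refine IsUnit.of_mul_eq_one ((algebraMap A L u)⁻¹ ⊗ₜ (algebraMap A L u)⁻¹) ?_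
    rw [Algebra.TensorProduct.tmul_mul_tmul, mul_inv_cancel₀ hu', Algebra.TensorProduct.one_def]
  refine mem_range_of_isNilpotent_tmul_sub (K := K) ?_
  have h2 := (Commute.all _ _).isNilpotent_mul_right h
    (y := (algebraMap A L u)⁻¹ ⊗ₜ[K] (algebraMap A L u)⁻¹)
  rwa [mul_assoc, Algebra.TensorProduct.tmul_mul_tmul, mul_inv_cancel₀ hu',
    ← Algebra.TensorProduct.one_def, mul_one] at h2

/-- Every regular function is a quotient of elements of a subalgebra that contains functions
separating the points of a nonempty open subset. -/
theorem exists_mul_mem_of_separatesPoints {A : Type} [CommRing A] [IsDomain A] [Algebra ℂ A]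
    [Algebra.FiniteType ℂ A] {N : ℕ} (f : Fin N → A) {U : (Spec (.of A)).Opens}
    (hU : (U : Set (Spec (.of A))).Nonempty) (hpts : SeparatesPoints f U)
    (B : Subalgebra ℂ A) (hB : ∀ k, f k ∈ B) (a : A) : ∃ b ∈ B, b ≠ 0 ∧ b * a ∈ B := by
  let K := FractionRing B
  let L := FractionRing A
  have : FaithfulSMul B L := .trans B A L
  let := FractionRing.liftAlgebra B L
  have : CharZero B := charZero_of_injective_algebraMap (algebraMap ℂ B).injective
  have : CharZero K := charZero_of_injective_algebraMap (IsFractionRing.injective B K)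
  obtain ⟨c, hc⟩ := algebraMap_mem_range_of_separatesPoints f hU hpts B hB (K := K) (L := L) a
  obtain ⟨p, q, hq, rfl⟩ := IsFractionRing.div_surjective (A := B) c
  have hq0 : (q : A) ≠ 0 := fun h0 => nonZeroDivisors.ne_zero hq (Subtype.ext h0)
  refine ⟨q, q.2, hq0, ?_⟩
  have : (q : A) * a = p := by
    apply IsFractionRing.injective A L
    rw [map_div₀, ← IsScalarTower.algebraMap_apply, ← IsScalarTower.algebraMap_apply,
      IsScalarTower.algebraMap_apply B A L, IsScalarTower.algebraMap_apply B A L] at hc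
    rw [map_mul, ← hc]
    exact mul_div_cancel₀ _ (by simpa using hq0)
  exact this ▸ p.2

/-! ### Common denominators -/

/-- A finitely generated algebra in which every element is a quotient of elements of a subalgebra
agrees with that subalgebra after inverting one element. -/
theorem exists_pow_mul_mem {k A : Type*} [Field k] [CommRing A] [IsDomain A] [Algebra k A]
    [Algebra.FiniteType k A] (B : Subalgebra k A) (h : ∀ a : A, ∃ b ∈ B, b ≠ 0 ∧ b * a ∈ B) :
    ∃ b ∈ B, b ≠ 0 ∧ ∀ a, ∃ n, b ^ n * a ∈ B := by
  obtain ⟨s, hs⟩ := (inferInstance : Algebra.FiniteType k A).out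
  choose d hdB hd0 hd using h
  -- The product of the denominators of a finite generating set.
  refine ⟨∏ a ∈ s, d a, prod_mem fun a _ => hdB a, Finset.prod_ne_zero_iff.2 fun a _ => hd0 a, ?_⟩
  have hb : ∏ a ∈ s, d a ∈ B := prod_mem fun a _ => hdB a
  intro a
  have ha : a ∈ Algebra.adjoin k (s : Set A) := hs ▸ Algebra.mem_top
  induction ha using Algebra.adjoin_induction with
  | mem x hx =>
    refine ⟨1, ?_⟩
    classical
    rw [pow_one, ← Finset.prod_erase_mul s d hx, mul_assoc]
    exact mul_mem (prod_mem fun a _ => hdB a) (hd x)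
  | algebraMap r => exact ⟨0, by simp [B.algebraMap_mem r]⟩
  | add x y _ _ hx hy =>
    obtain ⟨n, hn⟩ := hx
    obtain ⟨m, hm⟩ := hy
    refine ⟨n + m, ?_⟩
    convert add_mem (mul_mem (pow_mem hb m) hn) (mul_mem (pow_mem hb n) hm) using 1
    ring
  | mul x y _ _ hx hy =>
    obtain ⟨n, hn⟩ := hx
    obtain ⟨m, hm⟩ := hy
    refine ⟨n + m, ?_⟩
    convert mul_mem hn hm using 1
    ring

theorem isLocalization_away_of_exists_pow_mul_mem {k A : Type*} [Field k] [CommRing A] [IsDomain A]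
    [Algebra k A] (B : Subalgebra k A) (b : B) (hb : b ≠ 0)
    (h : ∀ a : A, ∃ n, (b : A) ^ n * a ∈ B) :
    IsLocalization.Away b (Localization.Away (b : A)) := by
  have hb0 : (b : A) ≠ 0 := by simpa using hb
  have hinj : Function.Injective (algebraMap A (Localization.Away (b : A))) :=
    IsLocalization.injective _ (powers_le_nonZeroDivisors_of_noZeroDivisors hb0)
  have htower (c : B) : algebraMap B (Localization.Away (b : A)) c =
    algebraMap A (Localization.Away (b : A)) c := rfl
  have hu : IsUnit (algebraMap A (Localization.Away (b : A)) b) :=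
    IsLocalization.Away.algebraMap_isUnit (b : A)
  refine IsLocalization.Away.mk _ ?_ ?_ ?_
  · exact hu
  · intro z
    obtain ⟨n, a, hz⟩ := IsLocalization.Away.surj (b : A) z
    obtain ⟨m, hm⟩ := h a
    refine ⟨n + m, ⟨_, hm⟩, ?_⟩
    rw [htower, htower, map_mul, ← hz, map_pow]
    ring
  · intro c d hcd
    exact ⟨0, by rw [Subtype.ext (hinj hcd)]⟩

/-! ### Scheme-theoretic images and open immersions -/

/-- A scheme-theoretically dominant morphism followed by a closed immersion identifies the
scheme-theoretic image. -/
theorem exists_iso_toImage {X Y Z : Scheme} (g : X ⟶ Y) (h : Y ⟶ Z)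
    [IsSchemeTheoreticallyDominant g] [IsClosedImmersion h] :
    ∃ e : Y ≅ (g ≫ h).image, g ≫ e.hom = (g ≫ h).toImage := by
  -- As g has zero kernel, the image of g ≫ h and h are closed immersions with the same ideal sheaf.
  have hk : (g ≫ h).imageι.ker = h.ker := by
    rw [Scheme.IdealSheafData.ker_subschemeι, Scheme.Hom.ker_comp, g.ker_eq_bot,
      Scheme.IdealSheafData.map_bot]
  have := IsClosedImmersion.isIso_lift _ _ hk
  refine ⟨asIso (IsClosedImmersion.lift (g ≫ h).imageι h hk.le), ?_⟩
  rw [← cancel_mono (g ≫ h).imageι]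
  simp

theorem isSchemeTheoreticallyDominant_Spec_map {R S : CommRingCat} (φ : R ⟶ S)
    (hφ : Function.Injective φ.hom) : IsSchemeTheoreticallyDominant (Spec.map φ) := by
  refine ⟨Scheme.IdealSheafData.ext_of_isAffine ?_⟩
  rw [Scheme.Hom.ker_apply, Scheme.IdealSheafData.ideal_bot, Pi.bot_apply,
    ← RingHom.injective_iff_ker_eq_bot]
  exact (MorphismProperty.arrow_mk_iso_iff
    (MorphismProperty.injective CommRingCat) (arrowIsoΓSpecOfIsAffine φ)).1 hφ

theorem surjective_of_isClosedImmersion_Spec_map {R S : CommRingCat} (φ : R ⟶ S)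
    [IsClosedImmersion (Spec.map φ)] : Function.Surjective φ.hom := by
  have := (IsClosedImmersion.isAffine_surjective_of_isAffine (Spec.map φ)).2
  exact (MorphismProperty.arrow_mk_iso_iff
    (MorphismProperty.surjective CommRingCat) (arrowIsoΓSpecOfIsAffine φ)).2 this

/-- The comorphism of an affine variety onto the closure of its image. -/
theorem mapToAffineSpace_eq {A : Type} [CommRing A] [Algebra ℂ A] {N : ℕ} (f : Fin N → A) :
    mapToAffineSpace f =
      Spec.map (CommRingCat.ofHom (algebraMap (MvPolynomial.aeval (R := ℂ) f).range A)) ≫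
      Spec.map (CommRingCat.ofHom (MvPolynomial.aeval (R := ℂ) f).rangeRestrict.toRingHom) := by
  rw [← Spec.map_comp, ← CommRingCat.ofHom_comp]
  rfl

/-- If a subalgebra contains functions separating the points of a nonempty open subset, the spectra
agree on a nonempty open subset. -/
theorem exists_isOpenImmersion_Spec_map {A : Type} [CommRing A] [IsDomain A] [Algebra ℂ A]
    [Algebra.FiniteType ℂ A] (B : Subalgebra ℂ A) (h : ∀ a : A, ∃ b ∈ B, b ≠ 0 ∧ b * a ∈ B)
    {U : (Spec (.of A)).Opens} (hU : (U : Set (Spec (.of A))).Nonempty) :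
    ∃ U' : (Spec (.of A)).Opens, (U' : Set (Spec (.of A))).Nonempty ∧ U' ≤ U ∧
      IsOpenImmersion (U'.ι ≫ Spec.map (CommRingCat.ofHom (algebraMap B A))) := by
  obtain ⟨b, hbB, hb0, hb⟩ := exists_pow_mul_mem B h
  have : IsLocalization.Away (⟨b, hbB⟩ : B) (Localization.Away b) :=
    isLocalization_away_of_exists_pow_mul_mem B ⟨b, hbB⟩ (by simpa [Subtype.ext_iff]) hb
  let j : Spec (.of (Localization.Away b)) ⟶ Spec (.of A) :=
    Spec.map (CommRingCat.ofHom (algebraMap A (Localization.Away b)))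
  have hj : IsOpenImmersion j := IsOpenImmersion.of_isLocalization b
  have hjB : IsOpenImmersion (j ≫ Spec.map (CommRingCat.ofHom (algebraMap B A))) := by
    rw [← Spec.map_comp, ← CommRingCat.ofHom_comp, ← IsScalarTower.algebraMap_eq]
    exact IsOpenImmersion.of_isLocalization (⟨b, hbB⟩ : B)
  have : IsDomain (Localization.Away b) := IsLocalization.Away.isDomain _ hb0
  have hne : (j.opensRange : Set (Spec (.of A))).Nonempty := by
    rw [Scheme.Hom.coe_opensRange]
    exact Set.range_nonempty _
  refine ⟨U ⊓ j.opensRange, ?_, inf_le_left, ?_⟩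
  -- Spec A is irreducible because A is a domain.
  · exact nonempty_preirreducible_inter U.isOpen j.opensRange.isOpen hU hne
  · have hr : Set.range (U ⊓ j.opensRange).ι ⊆ Set.range j := by
      rw [Scheme.Opens.range_ι]
      exact Set.inter_subset_right
    have hfac := IsOpenImmersion.lift_fac j (U ⊓ j.opensRange).ι hr
    have : IsOpenImmersion (IsOpenImmersion.lift j (U ⊓ j.opensRange).ι hr) := by
      have : IsOpenImmersion (IsOpenImmersion.lift j (U ⊓ j.opensRange).ι hr ≫ j) := by
        rw [hfac]
        infer_instance
      exact .of_comp _ j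
    rw [← hfac, Category.assoc]
    infer_instance

/-- The extension of δ kills ker δ, so FD(X) contains D(X), then the quotients that make up A, then
all fractions. -/
theorem fieldDerksen_eq_top {A : Type} [CommRing A] [IsDomain A] [Algebra ℂ A]
    (h : ∀ a : A, ∃ b ∈ derksen A, b ≠ 0 ∧ b * a ∈ derksen A) : fieldDerksen A = ⊤ := by
  have hle : ∀ b ∈ derksen A, algebraMap A (FractionRing A) b ∈ fieldDerksen A := by
    intro b hb
    induction hb using Algebra.adjoin_induction with
    | mem x hx =>
      obtain ⟨δ, hδ, hδ0, hx⟩ := hx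
      exact IntermediateField.subset_adjoin _ _
        ⟨δ, hδ, hδ0, by rw [extend_algebraMap, hx, map_zero]⟩
    | algebraMap r =>
      rw [← IsScalarTower.algebraMap_apply]
      exact (fieldDerksen A).algebraMap_mem r
    | add x y _ _ hx hy => rw [map_add]; exact add_mem hx hy
    | mul x y _ _ hx hy => rw [map_mul]; exact mul_mem hx hy
  have hA : ∀ a : A, algebraMap A (FractionRing A) a ∈ fieldDerksen A := by
    intro a
    obtain ⟨b, hb, hb0, hba⟩ := h a
    have hb0' : algebraMap A (FractionRing A) b ≠ 0 := by simpa using hb0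
    have := div_mem (hle _ hba) (hle _ hb)
    rwa [map_mul, mul_div_cancel_left₀ _ hb0'] at this
  refine eq_top_iff.2 fun g _ => ?_
  obtain ⟨p, q, -, rfl⟩ := IsFractionRing.div_surjective (A := A) g
  exact div_mem (hA p) (hA q)

end AffineVar

theorem proposition3p2 {A : Type} [CommRing A] [IsDomain A] [Algebra ℂ A] [Algebra.FiniteType ℂ A]
    {N : ℕ} (f : Fin N → A)
    (hker : ∀ k, ∃ δ : Derivation ℂ A A, AffineVar.IsLND δ ∧ δ ≠ 0 ∧ δ (f k) = 0)
    (U : (Spec (.of A)).Opens) (hU : (U : Set (Spec (.of A))).Nonempty)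
    (hpts : AffineVar.SeparatesPoints f U)
    (htan : ∃ V : (Spec (.of A)).Opens, (V : Set (Spec (.of A))).Nonempty ∧
      ∀ x : A →ₐ[ℂ] ℂ, AffineVar.pt x ∈ V → AffineVar.SeparatesTangentVectors f x) :
    (∃ U' : (Spec (.of A)).Opens, (U' : Set (Spec (.of A))).Nonempty ∧ U' ≤ U ∧
      IsOpenImmersion (U'.ι ≫ (AffineVar.mapToAffineSpace f).toImage)) ∧
    AffineVar.fieldDerksen A = ⊤ ∧
    (AffineVar.SeparatesPoints f ⊤ →
      (∀ x : A →ₐ[ℂ] ℂ, AffineVar.SeparatesTangentVectors f x) →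
      IsClosedImmersion (AffineVar.mapToAffineSpace f) →
      AffineVar.derksen A = ⊤) := by
  have hmem (k : Fin N) : f k ∈ AffineVar.derksen A := Algebra.subset_adjoin (hker k)
  refine ⟨?_, ?_, fun _ _ hF => ?_⟩
  -- Spec of B = ℂ[f_1, …, f_N] is the closure of F(X).
  · let B := (MvPolynomial.aeval (R := ℂ) f).range
    have hB (k : Fin N) : f k ∈ B := ⟨MvPolynomial.X k, MvPolynomial.aeval_X f k⟩
    obtain ⟨U', hne, hle, hU'⟩ := AffineVar.exists_isOpenImmersion_Spec_map B
      (AffineVar.exists_mul_mem_of_separatesPoints f hU hpts B hB) hU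
    refine ⟨U', hne, hle, ?_⟩
    have hdom : IsSchemeTheoreticallyDominant
        (Spec.map (CommRingCat.ofHom (algebraMap B A))) :=
      AffineVar.isSchemeTheoreticallyDominant_Spec_map _ Subtype.val_injective
    have hcl : IsClosedImmersion (Spec.map (CommRingCat.ofHom
        (MvPolynomial.aeval (R := ℂ) f).rangeRestrict.toRingHom)) :=
      .spec_of_surjective _ (MvPolynomial.aeval (R := ℂ) f).rangeRestrict_surjective
    obtain ⟨e, he⟩ := AffineVar.exists_iso_toImage
      (Spec.map (CommRingCat.ofHom (algebraMap B A)))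
      (Spec.map (CommRingCat.ofHom (MvPolynomial.aeval (R := ℂ) f).rangeRestrict.toRingHom))
    rw [AffineVar.mapToAffineSpace_eq, ← he, ← Category.assoc]
    infer_instance
  -- Here B is D(X) itself; no finite generation of B is needed.
  · exact AffineVar.fieldDerksen_eq_top
      (AffineVar.exists_mul_mem_of_separatesPoints f hU hpts _ hmem)
  · have : IsClosedImmersion (Spec.map
        (CommRingCat.ofHom (MvPolynomial.aeval (R := ℂ) f).toRingHom)) := hF
    have hsurj := AffineVar.surjective_of_isClosedImmersion_Spec_map
      (CommRingCat.ofHom (MvPolynomial.aeval (R := ℂ) f).toRingHom)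
    refine eq_top_iff.2 fun a _ => ?_
    obtain ⟨p, rfl⟩ := hsurj a
    have hle : (MvPolynomial.aeval (R := ℂ) f).range ≤ AffineVar.derksen A := by
      rw [← Algebra.adjoin_range_eq_range_aeval, Algebra.adjoin_le_iff]
      rintro _ ⟨k, rfl⟩
      exact hmem k
    exact hle ⟨p, rfl⟩
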